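/- Let $\mathbf C=\{0,1\}^{\mathbb N}$ be the Cantor set with its usual topology. For $A\subseteq\mathbf C$ let $\mathbf C_A$ denote the set $\mathbf C$ with the topology generated by the usual open sets of $\mathbf C$ together with the singletons $\{x\}$, $x\in A$ (the points of $A$ are made isolated). A real function on a topological space is of the first Baire class if it is a pointwise limit of a sequence of continuous real functions. A function $g$ on a product $\prod_{n=1}^\infty X_n$ is finitely determined if there is $N$ such that $g(x)=g(y)$ whenever $x_k=y_k$ for all $k\le N$; $\mathrm{CF}(\prod_n X_n)$ is the set of all continuous finitely determined functions $g:\prod_n X_n\to\mathbb R$. Theorem. There is a sequence $(A_n)_{n=1}^\infty$ of pairwise disjoint sets with $\bigcup_n A_n=\mathbf C$ such that, with $X_n=\mathbf C_{A_n}$, every $X_n$ is a Lindelöf completely regular $T_1$ space, the product $\prod_{n=1}^\infty X_n$ is completely regular and $T_1$, and: (i) for every $n\in\mathbb N$ the product $\prod_{k=1}^n X_k$ is Lindelöf; (ii) there is a function $f:\prod_{n=1}^\infty X_n\to\mathbb R$ of the first Baire class which is not a pointwise limit of any sequence of functions from $\mathrm{CF}(\prod_{n=1}^\infty X_n)$.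 In particular, the following question of Bykov has a negative answer: is every Baire-one function $f:X\to\mathbb R$ on a completely regular subspace $X$ of a countable product of topological spaces a pointwise limit of a sequence of continuous functions on $X$ that depend on finitely many coordinates? (Take $X$ to be the full product.) -/

import Mathlib

open Filter Topology

/-- The Cantor set `{0,1}^ℕ` (carrying Mathlib's product topology). -/
abbrev CantorSet : Type := ℕ → Bool

/-- The underlying set of the Cantor set, to be retopologized by making all points of `A`
isolated. It is a `def`, so that it does not inherit the usual topology. -/
def CantorIsolating (_A : Set CantorSet) : Type := CantorSet

/-- The topology of `CantorIsolating A`: it is generated by the usual open sets of the Cantor set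
together with all singletons `{x}`, `x ∈ A`. -/
instance CantorIsolating.instTopologicalSpace (A : Set CantorSet) :
    TopologicalSpace (CantorIsolating A) :=
  TopologicalSpace.generateFrom (α := CantorSet)
    ({U : Set CantorSet | IsOpen U} ∪ {S : Set CantorSet | ∃ x ∈ A, S = {x}})

/-- `f` is of the first Baire class: a pointwise limit of a sequence of continuous maps. -/
def IsBaireOne {X Y : Type*} [TopologicalSpace X] [TopologicalSpace Y] (f : X → Y) : Prop :=
  ∃ g : ℕ → X → Y, (∀ n, Continuous (g n)) ∧ ∀ x, Tendsto (fun n => g n x) atTop (𝓝 (f x))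

/-- A map on a countable product is finitely determined: for some `N` its value depends only on
the first `N` coordinates. -/
def IsFinitelyDetermined {X : ℕ → Type*} {Y : Type*} (f : (∀ n, X n) → Y) : Prop :=
  ∃ N : ℕ, ∀ x y : (∀ n, X n), (∀ k < N, x k = y k) → f x = f y

/-- The class `CF(∏ X_n, Y)` of continuous finitely determined maps. -/
def CF (X : ℕ → Type*) (Y : Type*) [∀ n, TopologicalSpace (X n)] [TopologicalSpace Y] :
    Set ((∀ n, X n) → Y) :=
  {f | Continuous f ∧ IsFinitelyDetermined f}

/-! Colour the Cantor set with countably many colours, Bernstein style, and let `A n` be the colour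
classes. A closed set in a finite power whose points all have a coordinate of the prescribed colour
is then thin: any non-thin closed set contains a Cantor set with injective coordinates, and
transfinite selection gives one of its points a colour that is not prescribed. Finite products are
Lindelöf because the usual interiors of a cover's members miss only a thin closed set, covered by
countably many hyperplanes, which are smaller products. On the diagonal, a function in `CF` is
continuous for the usual topology off a countable set, so a Baire category argument prevents such
functions from converging to the indicator of a certain dense meager set `⋃ j, evenZeroFrom j`. In
the full product, however, each diagonal point has an isolated coordinate, and this makes that
indicator the diagonal trace of a limit of indicators of clopen sets. -/

open Set Function
open scoped Cardinal

/-! ### Thin sets and Cantor schemes -/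

/-- A subset of a power `E ^ ι` is thin if it is covered by countably many hyperplanes
`{y | y k = s}`. -/
def IsThin {ι E : Type*} (S : Set (ι → E)) : Prop :=
  ∃ T : Set E, T.Countable ∧ ∀ y ∈ S, ∃ k, y k ∈ T

theorem IsThin.mono {ι E : Type*} {S S' : Set (ι → E)} (h : S ⊆ S') (hS : IsThin S') :
    IsThin S := by
  obtain ⟨T, hT, hS⟩ := hS
  exact ⟨T, hT, fun y hy => hS y (h hy)⟩

theorem IsThin.sUnion {ι E : Type*} {𝒮 : Set (Set (ι → E))} (h𝒮 : 𝒮.Countable)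
    (h : ∀ S ∈ 𝒮, IsThin S) : IsThin (⋃₀ 𝒮) := by
  choose! T hT hS using h
  refine ⟨⋃ S ∈ 𝒮, T S, h𝒮.biUnion hT, fun y hy => ?_⟩
  obtain ⟨S, hS𝒮, hyS⟩ := hy
  obtain ⟨k, hk⟩ := hS S hS𝒮 y hyS
  exact ⟨k, mem_biUnion hS𝒮 hk⟩

theorem IsThin.union {ι E : Type*} {S S' : Set (ι → E)} (hS : IsThin S) (hS' : IsThin S') :
    IsThin (S ∪ S') := by
  obtain ⟨T, hT, h⟩ := hS
  obtain ⟨T', hT', h'⟩ := hS'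
  refine ⟨T ∪ T', hT.union hT', ?_⟩
  rintro y (hy | hy)
  · exact (h y hy).imp fun k hk => Or.inl hk
  · exact (h' y hy).imp fun k hk => Or.inr hk

/-- The points at which a non-thin set is locally non-thin form a non-thin set. -/
theorem not_isThin_setOf_locally {ι E : Type*} [Finite ι] [TopologicalSpace E]
    [SecondCountableTopology E] {S : Set (ι → E)} (hS : ¬ IsThin S) :
    ¬ IsThin {x ∈ S | ∀ t ∈ 𝓝[S] x, ¬ IsThin t} := by
  intro h
  have hB : IsThin {x ∈ S | ∃ t ∈ 𝓝[S] x, IsThin t} := by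
    refine IsLindelof.induction_on (p := IsThin) (HereditarilyLindelofSpace.isLindelof _)
      (fun _ _ => IsThin.mono) (fun _ => IsThin.sUnion) ?_
    rintro x ⟨-, t, ht, htt⟩
    exact ⟨t, nhdsWithin_mono x (fun y hy => hy.1) ht, htt⟩
  refine hS ((h.union hB).mono fun x hx => ?_)
  by_cases hx' : ∃ t ∈ 𝓝[S] x, IsThin t
  · exact Or.inr ⟨hx, hx'⟩
  · push Not at hx'
    exact Or.inl ⟨hx, hx'⟩

/-- A closed non-thin set contains two closed non-thin sets that are disjoint in every
coordinate. -/
theorem exists_split_of_not_isThin {ι E : Type*} [Finite ι] [TopologicalSpace E]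
    [SecondCountableTopology E] [T3Space E] {S : Set (ι → E)} (hc : IsClosed S)
    (hS : ¬ IsThin S) :
    ∃ S₀ S₁ : Set (ι → E), (IsClosed S₀ ∧ ¬ IsThin S₀ ∧ S₀ ⊆ S) ∧
      (IsClosed S₁ ∧ ¬ IsThin S₁ ∧ S₁ ⊆ S) ∧ ∀ y ∈ S₀, ∀ z ∈ S₁, ∀ k, y k ≠ z k := by
  have hL := not_isThin_setOf_locally hS
  set L := {x ∈ S | ∀ t ∈ 𝓝[S] x, ¬ IsThin t} with hLdef
  obtain ⟨x, hx⟩ : L.Nonempty := by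
    by_contra h
    rw [not_nonempty_iff_eq_empty] at h
    exact hL ⟨∅, countable_empty, by simp [h]⟩
  -- The finitely many values of `x` define a thin set, which cannot contain `L`.
  obtain ⟨y, hy, hxy⟩ : ∃ y ∈ L, ∀ k, y k ∉ range x := by
    by_contra! h
    exact hL ⟨range x, countable_range x, h⟩
  have hne : ∀ k, x k ≠ y k := fun k h => hxy k ⟨k, h⟩
  choose U hxU hU V hyV hV hUV using fun k => exists_open_nhds_disjoint_closure (hne k)
  have key : ∀ (z : ι → E) (W : ι → Set E), z ∈ L → (∀ k, z k ∈ W k) → (∀ k, IsOpen (W k)) →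
      IsClosed (S ∩ univ.pi fun k => closure (W k)) ∧
      ¬ IsThin (S ∩ univ.pi fun k => closure (W k)) ∧
      (S ∩ univ.pi fun k => closure (W k)) ⊆ S := by
    intro z W hz hzW hW
    refine ⟨hc.inter (isClosed_set_pi fun k _ => isClosed_closure), hz.2 _ ?_, inter_subset_left⟩
    refine inter_mem self_mem_nhdsWithin (mem_nhdsWithin_of_mem_nhds ?_)
    exact set_pi_mem_nhds finite_univ fun k _ =>
      mem_of_superset ((hW k).mem_nhds (hzW k)) subset_closure
  refine ⟨_, _, key x U hx hxU hU, key y V hy hyV hV, ?_⟩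
  rintro a ⟨-, ha⟩ b ⟨-, hb⟩ k hab
  exact (hUV k).ne_of_mem (ha k trivial) (hb k trivial) hab

/-- A closed non-thin subset of a finite power of a compact space contains a copy of the Cantor
set on which all coordinates are injective. -/
theorem exists_coordinatewise_injective_of_not_isThin {ι E : Type*} [Finite ι]
    [TopologicalSpace E] [SecondCountableTopology E] [T3Space E] [CompactSpace E]
    {S : Set (ι → E)} (hc : IsClosed S) (hS : ¬ IsThin S) :
    ∃ φ : CantorSet → ι → E, (∀ s, φ s ∈ S) ∧ ∀ k, Injective fun s => φ s k := by
  let Big := {S : Set (ι → E) // IsClosed S ∧ ¬ IsThin S}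
  have hsplit : ∀ B : Big, ∃ F : Bool → Big, (∀ b, (F b).1 ⊆ B.1) ∧
      ∀ y ∈ (F false).1, ∀ z ∈ (F true).1, ∀ k, y k ≠ z k := by
    rintro ⟨B, hB, hB'⟩
    obtain ⟨S₀, S₁, h₀, h₁, h⟩ := exists_split_of_not_isThin hB hB'
    refine ⟨fun b => if b then ⟨S₁, h₁.1, h₁.2.1⟩ else ⟨S₀, h₀.1, h₀.2.1⟩, ?_, ?_⟩
    · rintro (_ | _)
      · simpa using h₀.2.2
      · simpa using h₁.2.2
    · simpa using h
  choose F hF hdisj using hsplit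
  -- A Cantor scheme: branches that part at stage `m` differ in every coordinate from then on.
  let D : CantorSet → ℕ → Big := fun s m => Nat.rec ⟨S, hc, hS⟩ (fun i B => F B (s i)) m
  have hDsucc : ∀ s m, D s (m + 1) = F (D s m) (s m) := fun s m => rfl
  have hDcongr : ∀ s t m, (∀ i < m, s i = t i) → D s m = D t m := by
    intro s t m
    induction m with
    | zero => intro _; rfl
    | succ m ih =>
      intro h
      rw [hDsucc, hDsucc, ih fun i hi => h i (by omega), h m (by omega)]
  have hne : ∀ B : Big, B.1.Nonempty := by
    rintro ⟨B, hB, hB'⟩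
    by_contra h
    rw [not_nonempty_iff_eq_empty] at h
    exact hB' ⟨∅, countable_empty, by simp [show B = ∅ from h]⟩
  have hmem : ∀ s, (⋂ m, (D s m).1).Nonempty := fun s =>
    IsCompact.nonempty_iInter_of_sequence_nonempty_isCompact_isClosed _
      (fun m => by rw [hDsucc]; exact hF _ _) (fun m => hne _) (D s 0).2.1.isCompact
      fun m => (D s m).2.1
  choose φ hφ using hmem
  simp only [mem_iInter] at hφ
  refine ⟨φ, fun s => hφ s 0, fun k s t hst => ?_⟩
  by_contra hne
  have hex : ∃ m, s m ≠ t m := Function.ne_iff.1 hne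
  classical
  let m := Nat.find hex
  have hm : s m ≠ t m := Nat.find_spec hex
  have hlt : ∀ i < m, s i = t i := fun i hi => not_not.1 (Nat.find_min hex hi)
  have h1 := hφ s (m + 1)
  have h2 := hφ t (m + 1)
  rw [hDsucc] at h1 h2
  rw [hDcongr s t m hlt] at h1
  cases hs : s m <;> cases ht : t m <;> rw [hs] at h1 <;> rw [ht] at h2
  · exact hm (hs.trans ht.symm)
  · exact hdisj _ _ h1 _ h2 k hst
  · exact hdisj _ _ h2 _ h1 k hst.symm
  · exact hm (hs.trans ht.symm)

/-! ### Transfinite selection and the Bernstein colouring -/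

section Selection

open Cardinal

/-- Given at most `#β` many families of finite sets indexed by the uncountable type `β`, each of
them point-finite, one can select a member of each family so that the selected sets are pairwise
disjoint. -/
theorem exists_pairwise_disjoint_selection {ι β : Type} {α : Type*} (hβ : ℵ₀ < #β)
    (hι : #ι ≤ #β) (F : ι → β → Set α) (hfin : ∀ i b, (F i b).Finite)
    (hF : ∀ i a, {b | a ∈ F i b}.Finite) :
    ∃ s : ι → β, Pairwise (Disjoint on fun i => F i (s i)) := by
  -- A well-order of minimal type makes every proper initial segment smaller than `#β`.
  obtain ⟨r, hr, hord⟩ := Cardinal.exists_ord_eq ι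
  have hlt : ∀ i, #{j // r j i} < #β := fun i => by
    have h1 : Ordinal.typein r i < (#ι).ord := hord ▸ Ordinal.typein_lt_type r i
    have h2 := Cardinal.lt_ord.1 h1
    rw [Ordinal.card_typein] at h2
    exact h2.trans_le hι
  have hstep : ∀ (i : ι) (p : ∀ j, r j i → β),
      ∃ b : β, ∀ j (hj : r j i), Disjoint (F j (p j hj)) (F i b) := by
    intro i p
    -- The choices excluded by stage `j`; each stage excludes only finitely many.
    let B : {j // r j i} → Set β := fun j => ⋃ a ∈ F j.1 (p j.1 j.2), {b | a ∈ F i b}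
    have hB : ∀ j, #(B j) ≤ ℵ₀ := fun j =>
      ((hfin _ _).biUnion fun a _ => hF i a).countable.le_aleph0
    have hU : #(⋃ j, B j) < #β := by
      calc #(⋃ j, B j) ≤ sum fun j => #(B j) := mk_iUnion_le_sum_mk
        _ ≤ sum fun _ : {j // r j i} => ℵ₀ := sum_le_sum _ _ hB
        _ = #{j // r j i} * ℵ₀ := by simp
        _ < #β := mul_lt_of_lt hβ.le (hlt i) hβ
    obtain ⟨b, hb⟩ : ∃ b, b ∉ ⋃ j, B j := by
      by_contra! h
      rw [eq_univ_of_forall h, mk_univ] at hU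
      exact hU.false
    refine ⟨b, fun j hj => Set.disjoint_left.2 fun a ha ha' => hb ?_⟩
    exact mem_iUnion.2 ⟨⟨j, hj⟩, mem_biUnion ha ha'⟩
  choose G hG using hstep
  have hwf : WellFounded r := hr.wf
  refine ⟨hwf.fix G, fun i j hij => ?_⟩
  have key : ∀ i j, r j i → Disjoint (F j (hwf.fix G j)) (F i (hwf.fix G i)) := by
    intro i j hj
    rw [hwf.fix_eq G i]
    exact hG i (fun j _ => hwf.fix G j) j hj
  rcases trichotomous_of r i j with h | h | h
  · exact key j i h
  · exact absurd h hij
  · exact (key i j h).symm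

theorem mk_closeds_le_continuum {X : Type} [TopologicalSpace X] [SecondCountableTopology X] :
    #(TopologicalSpace.Closeds X) ≤ 𝔠 := by
  have hb := TopologicalSpace.isBasis_countableBasis X
  let f : Set (TopologicalSpace.countableBasis X) → Set X := fun s => (⋃ u ∈ s, u.1)ᶜ
  have hinj : ∀ K : TopologicalSpace.Closeds X, ∃ s, f s = K := by
    intro K
    obtain ⟨S, hS, hK⟩ := hb.open_eq_sUnion K.isClosed.isOpen_compl
    refine ⟨{u | u.1 ∈ S}, ?_⟩
    rw [← compl_compl (K : Set X), hK]
    refine congrArg compl (Set.ext fun x => ?_)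
    simp only [mem_iUnion, mem_ofPred_eq, mem_sUnion, Subtype.exists, exists_prop]
    constructor
    · rintro ⟨u, hu, huS, hx⟩
      exact ⟨u, huS, hx⟩
    · rintro ⟨u, huS, hx⟩
      exact ⟨u, hS huS, huS, hx⟩
  choose g hg using hinj
  have hginj : Injective g := fun K L h => SetLike.coe_injective (by rw [← hg, ← hg, h])
  calc #(TopologicalSpace.Closeds X) ≤ #(Set (TopologicalSpace.countableBasis X)) :=
        mk_le_of_injective hginj
    _ = 2 ^ #(TopologicalSpace.countableBasis X) := mk_set
    _ ≤ 2 ^ ℵ₀ := power_le_power_left two_ne_zero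
        (TopologicalSpace.countable_countableBasis X).le_aleph0
    _ = 𝔠 := two_power_aleph0

/-- A Bernstein-type colouring of the Cantor set: a closed subset of a finite power all of whose
points have some coordinate of a prescribed colour is thin. -/
theorem exists_bernstein_colouring :
    ∃ c : CantorSet → ℕ, ∀ (n : ℕ) (e : Fin n → ℕ) (K : Set (Fin n → CantorSet)), IsClosed K →
      (∀ y ∈ K, ∃ k, c (y k) = e k) → IsThin K := by
  let ι := Σ n : ℕ, {p : (Fin n → ℕ) × TopologicalSpace.Closeds (Fin n → CantorSet) //
    ¬ IsThin (p.2 : Set (Fin n → CantorSet))}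
  have hβ : #CantorSet = 𝔠 := by simp [CantorSet]
  have hι : #ι ≤ #CantorSet := by
    rw [hβ, mk_sigma]
    calc _ ≤ sum fun _ : ℕ => 𝔠 := by
          refine sum_le_sum _ _ fun n => (mk_subtype_le _).trans ?_
          rw [mk_prod, lift_id, lift_id]
          have h : #(Fin n → ℕ) ≤ 𝔠 := mk_le_aleph0.trans aleph0_le_continuum
          exact (mul_le_mul' h mk_closeds_le_continuum).trans_eq continuum_mul_self
      _ ≤ 𝔠 := by simp
  choose φ hφK hφinj using fun i : ι =>
    exists_coordinatewise_injective_of_not_isThin i.2.1.2.isClosed i.2.2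
  obtain ⟨s, hs⟩ := exists_pairwise_disjoint_selection (β := CantorSet)
    (hβ ▸ aleph0_lt_continuum) hι (fun i b => range (φ i b)) (fun i b => finite_range _)
    (fun i a => by
      have : {b | a ∈ range (φ i b)} = ⋃ k, {b | φ i b k = a} := by ext; simp
      rw [this]
      exact finite_iUnion fun k => Set.Subsingleton.finite fun b hb b' hb' =>
        hφinj i k (hb.trans hb'.symm))
  -- A prescription uses finitely many of the infinitely many colours. Points never selected get
  -- colour 0, which is harmless.
  have hfresh : ∀ i : ι, ∃ N, N ∉ range i.2.1.1 := fun i =>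
    (finite_range i.2.1.1).infinite_compl.nonempty
  choose N hN using hfresh
  classical
  let c : CantorSet → ℕ := fun x =>
    if h : ∃ i, x ∈ range (φ i (s i)) then N h.choose else 0
  have hc : ∀ i k, c (φ i (s i) k) = N i := by
    intro i k
    have h : ∃ j, φ i (s i) k ∈ range (φ j (s j)) := ⟨i, mem_range_self k⟩
    have : h.choose = i := by
      by_contra hne
      exact Set.disjoint_left.1 (hs hne) h.choose_spec (mem_range_self k)
    simp only [c, dif_pos h, this]
  refine ⟨c, fun n e K hK hKc => ?_⟩
  by_contra hthin
  let i : ι := ⟨n, ⟨(e, ⟨K, hK⟩), hthin⟩⟩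
  obtain ⟨k, hk⟩ := hKc _ (hφK i (s i))
  rw [hc] at hk
  exact hN i ⟨k, hk.symm⟩

end Selection

/-! ### The Cantor set with isolated points -/

namespace CantorIsolating

variable {A : Set CantorSet}

/-- The identity map to the Cantor set with its usual topology. -/
def toCantor (x : CantorIsolating A) : CantorSet := x

/-- The identity map from the Cantor set with its usual topology. -/
def ofCantor (A : Set CantorSet) (x : CantorSet) : CantorIsolating A := x

theorem continuous_toCantor : Continuous (toCantor : CantorIsolating A → CantorSet) :=
  ⟨fun _ hU => TopologicalSpace.isOpen_generateFrom_of_mem (Or.inl hU)⟩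

theorem isOpen_singleton {x : CantorIsolating A} (hx : toCantor x ∈ A) :
    IsOpen ({x} : Set (CantorIsolating A)) :=
  TopologicalSpace.isOpen_generateFrom_of_mem (Or.inr ⟨toCantor x, hx, rfl⟩)

theorem continuousAt_ofCantor {x : CantorSet} (hx : x ∉ A) : ContinuousAt (ofCantor A) x := by
  refine TopologicalSpace.tendsto_nhds_generateFrom_iff.2 ?_
  rintro U (hU | ⟨y, hy, rfl⟩) hxU
  · exact IsOpen.mem_nhds hU hxU
  · obtain rfl : x = y := hxU
    exact absurd hy hx

instance : T2Space (CantorIsolating A) :=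
  T2Space.of_injective_continuous (f := toCantor) (fun _ _ h => h) continuous_toCantor

theorem isTopologicalBasis_isClopen :
    TopologicalSpace.IsTopologicalBasis {s : Set (CantorIsolating A) | IsClopen s} := by
  refine TopologicalSpace.isTopologicalBasis_of_isOpen_of_nhds (fun s hs => hs.isOpen) ?_
  intro x U hxU hU
  by_cases hx : toCantor x ∈ A
  · exact ⟨{x}, ⟨isClosed_singleton, isOpen_singleton hx⟩, rfl, singleton_subset_iff.2 hxU⟩
  · have hn : ofCantor A ⁻¹' U ∈ 𝓝 (toCantor x) := continuousAt_ofCantor hx (hU.mem_nhds hxU)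
    obtain ⟨V, hVU, hV, hxV⟩ := mem_nhds_iff.1 hn
    obtain ⟨W, hW, hxW, hWV⟩ := compact_exists_isClopen_in_isOpen hV hxV
    exact ⟨toCantor ⁻¹' W, hW.preimage continuous_toCantor, hxW, fun y hy => hVU (hWV hy)⟩

instance : T35Space (CantorIsolating A) :=
  { toT0Space := inferInstance
    toCompletelyRegularSpace :=
      CompletelyRegularSpace.of_isTopologicalBasis_clopens isTopologicalBasis_isClopen }

end CantorIsolating

/-! ### Lindelöf finite products and traces on the diagonal -/

/-- A sequence of subsets of the Cantor set is power-Bernstein if every closed subset of a finite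
power all of whose points have some coordinate in the prescribed member is thin. -/
def IsPowerBernstein (A : ℕ → Set CantorSet) : Prop :=
  ∀ (n : ℕ) (e : Fin n → ℕ) (K : Set (Fin n → CantorSet)), IsClosed K →
    (∀ y ∈ K, ∃ k, y k ∈ A (e k)) → IsThin K

namespace IsPowerBernstein

open CantorIsolating

variable {A : ℕ → Set CantorSet}

/-- Induction on `n`; `e` is arbitrary because fixing one coordinate leaves a product over an
arbitrary list of indices. -/
theorem lindelofSpace_pi_fin (hA : IsPowerBernstein A) (n : ℕ) (e : Fin n → ℕ) :
    LindelofSpace (∀ k, CantorIsolating (A (e k))) := by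
  induction n with
  | zero => infer_instance
  | succ n ih =>
    refine isLindelof_univ_iff.1 (isLindelof_of_countable_subcover fun U hU hcov => ?_)
    let of : (Fin (n + 1) → CantorSet) → ∀ k, CantorIsolating (A (e k)) :=
      fun y k => ofCantor _ (y k)
    obtain ⟨J, hJ, hJU⟩ := TopologicalSpace.isOpen_iUnion_countable
      (fun i => interior (of ⁻¹' U i)) fun _ => isOpen_interior
    -- At a point with no isolated coordinate, the two product topologies have the same
    -- neighbourhoods, so such a point lies in one of the interiors.
    have hK : IsThin (⋃ i, interior (of ⁻¹' U i))ᶜ := by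
      refine hA (n + 1) e _ (isOpen_iUnion fun _ => isOpen_interior).isClosed_compl ?_
      intro y hy
      by_contra! hyA
      obtain ⟨i, hi⟩ := mem_iUnion.1 (hcov (mem_univ (of y)))
      have hcont : ContinuousAt of y := continuousAt_pi.2 fun k =>
        ContinuousAt.comp (f := fun y : Fin (n + 1) → CantorSet => y k)
          (continuousAt_ofCantor (hyA k)) (continuous_apply k).continuousAt
      exact hy (mem_iUnion.2 ⟨i, mem_interior_iff_mem_nhds.2
        (hcont.preimage_mem_nhds ((hU i).mem_nhds hi))⟩)
    obtain ⟨T, hT, hTK⟩ := hK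
    have hL : IsLindelof (⋃ k : Fin (n + 1), ⋃ s ∈ T,
        range fun z : ∀ j, CantorIsolating (A (e (k.succAbove j))) =>
        k.insertNth (α := fun k => CantorIsolating (A (e k))) (ofCantor _ s) z) := by
      refine isLindelof_iUnion fun k => hT.isLindelof_biUnion fun s _ => ?_
      have := ih fun j => e (k.succAbove j)
      exact isLindelof_range (continuous_const.finInsertNth k continuous_id)
    obtain ⟨J', hJ', hJU'⟩ := hL.elim_countable_subcover U hU ((subset_univ _).trans hcov)
    refine ⟨J ∪ J', hJ.union hJ', fun x _ => ?_⟩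
    rw [biUnion_union]
    by_cases hx : (fun k => toCantor (x k)) ∈ ⋃ i, interior (of ⁻¹' U i)
    · left
      rw [← hJU] at hx
      obtain ⟨i, hi, hxi⟩ := mem_iUnion₂.1 hx
      exact mem_biUnion hi (interior_subset hxi : _ ∈ of ⁻¹' U i)
    · right
      obtain ⟨k, hk⟩ := hTK _ hx
      refine hJU' (mem_iUnion.2 ⟨k, mem_biUnion hk ⟨fun j => x (k.succAbove j), ?_⟩⟩)
      exact Fin.insertNth_self_removeNth k x

theorem lindelofSpace (hA : IsPowerBernstein A) (n : ℕ) :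
    LindelofSpace (CantorIsolating (A n)) := by
  have := hA.lindelofSpace_pi_fin 1 fun _ => n
  have h : IsLindelof (range fun y : Fin 1 → CantorIsolating (A n) => y 0) :=
    isLindelof_range (continuous_apply 0)
  rw [Surjective.range_eq fun x => ⟨fun _ => x, rfl⟩] at h
  exact isLindelof_univ_iff.1 h

/-- The diagonal copy of `K` is thin, and a hyperplane meets the diagonal in one point. -/
theorem countable_of_isClosed (hA : IsPowerBernstein A) {N : ℕ} {K : Set CantorSet}
    (hK : IsClosed K) (hKA : ∀ x ∈ K, ∃ k < N, x ∈ A k) : K.Countable := by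
  let d : CantorSet → Fin N → CantorSet := fun x _ => x
  have hd : Continuous d := continuous_pi fun _ => continuous_id
  obtain ⟨T, hT, hTK⟩ := hA N Fin.val (d '' K) (hK.isCompact.image hd).isClosed (by
    rintro _ ⟨x, hx, rfl⟩
    obtain ⟨k, hk, hxk⟩ := hKA x hx
    exact ⟨⟨k, hk⟩, hxk⟩)
  refine hT.mono fun x hx => ?_
  obtain ⟨k, hk⟩ := hTK (d x) (mem_image_of_mem d hx)
  exact hk

/-- A continuous finitely determined function, restricted to the diagonal, is continuous in the
usual topology of the Cantor set off a countable set. -/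
theorem countable_not_continuousAt_diag (hA : IsPowerBernstein A)
    {g : (∀ n, CantorIsolating (A n)) → ℝ} (hg : g ∈ CF (fun n => CantorIsolating (A n)) ℝ) :
    {x : CantorSet | ¬ ContinuousAt (fun x => g fun n => ofCantor (A n) x) x}.Countable := by
  obtain ⟨hgc, N, hN⟩ := hg
  have hsub : ∀ x : CantorSet, (∀ k < N, x ∉ A k) →
      ContinuousAt (fun x => g fun n => ofCantor (A n) x) x := by
    intro x hx
    -- The coordinates from `N` on, where `x` may be isolated, are frozen; `g` does not see them.
    let p : CantorSet → ∀ n, CantorIsolating (A n) :=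
      fun z n => if n < N then ofCantor (A n) z else ofCantor (A n) x
    have hp : ContinuousAt p x := by
      refine continuousAt_pi.2 fun n => ?_
      by_cases hn : n < N
      · simpa only [p, if_pos hn] using continuousAt_ofCantor (hx n hn)
      · simpa only [p, if_neg hn] using continuousAt_const
    have heq : (fun x => g fun n => ofCantor (A n) x) = g ∘ p :=
      funext fun z => hN _ _ fun k hk => by simp only [p, if_pos hk]
    rw [heq]
    exact hgc.continuousAt.comp hp
  -- The discontinuities form an Fσ set inside the first `N` colour classes, so each closed piece is
  -- countable.
  have hG : IsGδ {x : CantorSet | ContinuousAt (fun x => g fun n => ofCantor (A n) x) x} :=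
    IsGδ.setOfPred_continuousAt _
  obtain ⟨F, hF, hFeq⟩ := hG.eq_iInter_nat
  have hcompl : {x : CantorSet | ¬ ContinuousAt (fun x => g fun n => ofCantor (A n) x) x} =
      ⋃ n, (F n)ᶜ := by
    rw [← compl_iInter, ← hFeq]
    rfl
  rw [hcompl]
  refine countable_iUnion fun n => hA.countable_of_isClosed (N := N) (hF n).isClosed_compl ?_
  intro x hx
  by_contra! h
  have : x ∈ ⋃ n, (F n)ᶜ := mem_iUnion.2 ⟨n, hx⟩
  rw [← hcompl] at this
  exact this (hsub x h)

end IsPowerBernstein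

/-! ### The Baire category obstruction -/

namespace CantorSet

theorem exists_forall_mem_of_mem_nhds {x : CantorSet} {U : Set CantorSet} (hU : U ∈ 𝓝 x) :
    ∃ n, ∀ y : CantorSet, (∀ i < n, y i = x i) → y ∈ U := by
  obtain ⟨V, ⟨z, n, rfl⟩, hx, hV⟩ :=
    (PiNat.isTopologicalBasis_cylinders fun _ : ℕ => Bool).mem_nhds_iff.1 hU
  exact ⟨n, fun y hy => hV fun i hi => (hy i hi).trans (hx i hi)⟩

/-- The sequences that vanish at all even places from `j` on. -/
def evenZeroFrom (j : ℕ) : Set CantorSet := {x | ∀ b, j ≤ b → Even b → x b = false}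

theorem monotone_evenZeroFrom : Monotone evenZeroFrom :=
  fun _ _ h _ hx b hb => hx b (h.trans hb)

theorem isClosed_evenZeroFrom (j : ℕ) : IsClosed (evenZeroFrom j) := by
  simp only [evenZeroFrom, ofPred_forall]
  exact isClosed_iInter fun b => isClosed_iInter fun _ => isClosed_iInter fun _ =>
    isClosed_eq (continuous_apply b) continuous_const

theorem interior_evenZeroFrom (j : ℕ) : interior (evenZeroFrom j) = ∅ := by
  refine eq_empty_of_forall_notMem fun x hx => ?_
  obtain ⟨n, hn⟩ := exists_forall_mem_of_mem_nhds (mem_interior_iff_mem_nhds.1 hx)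
  have h := hn (fun i => if i < n then x i else true) (fun i hi => if_pos hi) (2 * (n + j))
    (by omega) (even_two_mul _)
  simp only [if_neg (show ¬ 2 * (n + j) < n by omega)] at h
  cases h

theorem not_countable_iUnion_evenZeroFrom_inter {U : Set CantorSet} (hU : IsOpen U)
    (hne : U.Nonempty) : ¬ ((⋃ j, evenZeroFrom j) ∩ U).Countable := by
  intro hc
  obtain ⟨x, hx⟩ := hne
  obtain ⟨n, hn⟩ := exists_forall_mem_of_mem_nhds (hU.mem_nhds hx)
  -- Past the prefix, `s` is coded in the odd places.
  let φ : CantorSet → CantorSet := fun s i =>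
    if i < n then x i else if Even i then false else s (i / 2 - n)
  have hφ : ∀ s, φ s ∈ (⋃ j, evenZeroFrom j) ∩ U := by
    refine fun s => ⟨mem_iUnion.2 ⟨n, fun b hb he => ?_⟩, hn _ fun i hi => if_pos hi⟩
    simp only [φ, if_neg (not_lt.2 hb), if_pos he]
  have hinj : Injective φ := by
    intro s t h
    funext i
    have h' := congrFun h (2 * (i + n) + 1)
    have h1 : ¬ 2 * (i + n) + 1 < n := by omega
    have h2 : ¬ Even (2 * (i + n) + 1) := by simp
    have h3 : (2 * (i + n) + 1) / 2 - n = i := by omega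
    simpa only [φ, if_neg h1, if_neg h2, h3] using h'
  have huniv : (univ : Set CantorSet).Countable :=
    (hc.preimage_of_injOn hinj.injOn).mono fun s _ => hφ s
  have h1 : #CantorSet ≤ ℵ₀ := by
    rw [← Cardinal.mk_univ]
    exact huniv.le_aleph0
  have h2 : #CantorSet = 𝔠 := by simp [CantorSet]
  exact absurd (h2 ▸ h1) (not_le.2 Cardinal.aleph0_lt_continuum)

/-- The indicator of the set of sequences eventually vanishing at even places is not a limit of
functions that are continuous off countable sets. -/
theorem not_tendsto_of_countable_not_continuousAt {h : ℕ → CantorSet → ℝ}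
    (hc : ∀ m, {x | ¬ ContinuousAt (h m) x}.Countable)
    (h1 : ∀ x ∈ ⋃ j, evenZeroFrom j, Tendsto (fun m => h m x) atTop (𝓝 1))
    (h0 : ∀ x ∉ ⋃ j, evenZeroFrom j, Tendsto (fun m => h m x) atTop (𝓝 0)) : False := by
  let P : ℕ → Set CantorSet := fun M => {x | ∀ m, M ≤ m → h m x ≤ 1 / 2}
  -- By Baire category some closed piece has interior, and it must be some `closure (P M)`.
  have hcov : (⋃ i, Sum.elim evenZeroFrom (fun M => closure (P M)) i) = univ := by
    refine eq_univ_of_forall fun x => mem_iUnion.2 ?_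
    by_cases hx : x ∈ ⋃ j, evenZeroFrom j
    · obtain ⟨j, hj⟩ := mem_iUnion.1 hx
      exact ⟨Sum.inl j, hj⟩
    · obtain ⟨M, hM⟩ := eventually_atTop.1
        ((h0 x hx).eventually_le_const (show (0 : ℝ) < 1 / 2 by norm_num))
      exact ⟨Sum.inr M, subset_closure hM⟩
  obtain ⟨i, hi⟩ := nonempty_interior_of_iUnion_of_closed (ι := ℕ ⊕ ℕ) (by
    rintro (j | M)
    · exact isClosed_evenZeroFrom j
    · exact isClosed_closure) hcov
  rcases i with j | M
  · simp [interior_evenZeroFrom] at hi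
  · have hnc := not_countable_iUnion_evenZeroFrom_inter isOpen_interior hi
    obtain ⟨x, ⟨hxT, hxP⟩, hxc⟩ : ∃ x ∈ (⋃ j, evenZeroFrom j) ∩ interior (closure (P M)),
        x ∉ ⋃ m, {x | ¬ ContinuousAt (h m) x} := by
      by_contra! hsub
      exact hnc ((countable_iUnion hc).mono hsub)
    have hle : ∀ m, M ≤ m → h m x ≤ 1 / 2 := by
      intro m hm
      have hcont : ContinuousAt (h m) x := by
        by_contra hn
        exact hxc (mem_iUnion.2 ⟨m, hn⟩)
      have hxcl : x ∈ closure (P M) := interior_subset hxP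
      have : h m x ∈ closure (h m '' P M) := mem_closure_image hcont hxcl
      refine closure_minimal ?_ isClosed_Iic this
      rintro _ ⟨y, hy, rfl⟩
      exact hy m hm
    have := le_of_tendsto (h1 x hxT) (eventually_atTop.2 ⟨M, hle⟩)
    norm_num at this

end CantorSet

/-! ### A Baire-one function on the full product -/

namespace CantorIsolating

open CantorSet

variable {A : ℕ → Set CantorSet}

/-- The points of the product whose first `k` coordinates agree up to place `k`. -/
def agreeUpTo (A : ℕ → Set CantorSet) (k : ℕ) : Set (∀ n, CantorIsolating (A n)) :=
  {y | ∀ i < k, ∀ b < k, toCantor (y i) b = toCantor (y 0) b}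

/-- A clopen set of points of the product whose trace on the diagonal is `evenZeroFrom j`. -/
def agreeEvenZero (A : ℕ → Set CantorSet) (j : ℕ) : Set (∀ n, CantorIsolating (A n)) :=
  {y | y ∈ agreeUpTo A j ∧
    ∀ k, y ∈ agreeUpTo A k → ∀ b < k, j ≤ b → Even b → toCantor (y 0) b = false}

theorem antitone_agreeUpTo : Antitone (agreeUpTo A) :=
  fun _ _ h _ hy i hi b hb => hy i (hi.trans_le h) b (hb.trans_le h)

theorem continuous_toCantor_apply (i b : ℕ) :
    Continuous fun y : ∀ n, CantorIsolating (A n) => toCantor (y i) b :=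
  (continuous_apply b).comp (continuous_toCantor.comp (continuous_apply i))

theorem isClopen_agreeUpTo (k : ℕ) : IsClopen (agreeUpTo A k) := by
  have : agreeUpTo A k = ⋂ i ∈ Iio k, ⋂ b ∈ Iio k,
      {y | toCantor (y i) b = toCantor (y 0) b} := by
    ext y
    simp [agreeUpTo]
  rw [this]
  refine (finite_Iio k).isClopen_biInter fun i _ => (finite_Iio k).isClopen_biInter fun b _ => ?_
  have : IsClopen {p : Bool × Bool | p.1 = p.2} := isClopen_discrete _
  exact this.preimage ((continuous_toCantor_apply i b).prodMk (continuous_toCantor_apply 0 b))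

theorem isClopen_apply_eq_false (b : ℕ) :
    IsClopen {y : ∀ n, CantorIsolating (A n) | toCantor (y 0) b = false} :=
  (isClopen_discrete {false}).preimage (continuous_toCantor_apply 0 b)

/-- The part of the condition defining `agreeEvenZero` at level `k`. -/
theorem isClopen_level (j k : ℕ) : IsClopen {y : ∀ n, CantorIsolating (A n) |
    y ∈ agreeUpTo A k → ∀ b < k, j ≤ b → Even b → toCantor (y 0) b = false} := by
  have : {y : ∀ n, CantorIsolating (A n) |
      y ∈ agreeUpTo A k → ∀ b < k, j ≤ b → Even b → toCantor (y 0) b = false} =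
      (agreeUpTo A k)ᶜ ∪ ⋂ b ∈ {b | b < k ∧ j ≤ b ∧ Even b}, {y | toCantor (y 0) b = false} := by
    ext y
    simp [imp_iff_not_or (a := y ∈ agreeUpTo A k)]
  rw [this]
  exact (isClopen_agreeUpTo k).compl.union
    (((finite_Iio k).subset fun b hb => hb.1).isClopen_biInter fun b _ => isClopen_apply_eq_false b)

theorem isClosed_agreeEvenZero (j : ℕ) : IsClosed (agreeEvenZero A j) := by
  have : agreeEvenZero A j = agreeUpTo A j ∩ ⋂ k, {y : ∀ n, CantorIsolating (A n) |
      y ∈ agreeUpTo A k → ∀ b < k, j ≤ b → Even b → toCantor (y 0) b = false} := by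
    ext y
    simp [agreeEvenZero]
  rw [this]
  exact (isClopen_agreeUpTo j).isClosed.inter (isClosed_iInter fun k => (isClopen_level j k).isClosed)

theorem eq_diag_of_forall_mem_agreeUpTo {y : ∀ n, CantorIsolating (A n)}
    (hy : ∀ k, y ∈ agreeUpTo A k) (n : ℕ) : toCantor (y n) = toCantor (y 0) := by
  funext b
  exact hy (n + b + 1) n (by omega) b (by omega)

/-- Near a diagonal point, an isolated coordinate `n` can be held fixed, and agreement with it
controls all levels at once. Off the diagonal, only finitely many levels matter. -/
theorem isOpen_agreeEvenZero (hA : (⋃ n, A n) = univ) (j : ℕ) : IsOpen (agreeEvenZero A j) := by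
  rw [isOpen_iff_mem_nhds]
  intro y hy
  by_cases hdiag : ∀ k, y ∈ agreeUpTo A k
  · obtain ⟨n, hn⟩ := mem_iUnion.1 (hA ▸ mem_univ (toCantor (y 0)) : toCantor (y 0) ∈ ⋃ n, A n)
    have hyn := eq_diag_of_forall_mem_agreeUpTo hdiag n
    have h1 : ∀ᶠ z in 𝓝 y, z n = y n :=
      (continuous_apply n).continuousAt.preimage_mem_nhds
        ((isOpen_singleton (by rwa [hyn])).mem_nhds (mem_singleton (y n)))
    have h2 : ∀ᶠ z in 𝓝 y, z ∈ agreeUpTo A (max (n + 1) j) :=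
      (isClopen_agreeUpTo _).isOpen.mem_nhds (hdiag _)
    filter_upwards [h1, h2] with z hz1 hz2
    refine ⟨antitone_agreeUpTo (le_max_right _ _) hz2, fun k hk b hb hjb he => ?_⟩
    -- Level `k` may not reach coordinate `n`; agreement up to `n + 1` fills the gap.
    have hmax : z ∈ agreeUpTo A (max k (n + 1)) := by
      rcases le_total k (n + 1) with h | h
      · rw [max_eq_right h]
        exact antitone_agreeUpTo (le_max_left _ _) hz2
      · rwa [max_eq_left h]
    rw [← hmax n (by omega) b (by omega), hz1, hyn]
    exact hy.2 (b + 1) (hdiag _) b (by omega) hjb he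
  · push Not at hdiag
    obtain ⟨k, hk⟩ := hdiag
    have h1 : ∀ᶠ z in 𝓝 y, z ∈ agreeUpTo A j := (isClopen_agreeUpTo j).isOpen.mem_nhds hy.1
    have h2 : ∀ᶠ z in 𝓝 y, z ∉ agreeUpTo A k := (isClopen_agreeUpTo k).compl.isOpen.mem_nhds hk
    have h3 : ∀ᶠ z in 𝓝 y, ∀ l ∈ Iio k,
        z ∈ agreeUpTo A l → ∀ b < l, j ≤ b → Even b → toCantor (z 0) b = false :=
      (eventually_all_finite (finite_Iio k)).2 fun l _ =>
        (isClopen_level j l).isOpen.mem_nhds (hy.2 l)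
    filter_upwards [h1, h2, h3] with z hz1 hz2 hz3
    refine ⟨hz1, fun l hl => hz3 l ?_ hl⟩
    by_contra hkl
    exact hz2 (antitone_agreeUpTo (not_lt.1 hkl) hl)

/-- There is a Baire-one function on the product whose restriction to the diagonal is the
indicator of the set of sequences eventually vanishing at even places. -/
theorem exists_isBaireOne_diag (hA : (⋃ n, A n) = univ) :
    ∃ f : (∀ n, CantorIsolating (A n)) → ℝ, IsBaireOne f ∧
      ∀ x : CantorSet, f (fun n => ofCantor (A n) x) =
        (⋃ j, evenZeroFrom j).indicator (fun _ => (1 : ℝ)) x := by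
  have hdiag : ∀ (x : CantorSet) (k : ℕ), (fun n => ofCantor (A n) x) ∈ agreeUpTo A k :=
    fun x k i _ b _ => rfl
  have hlim : ∀ y : ∀ n, CantorIsolating (A n), ∃ a : ℝ,
      Tendsto (fun j => (agreeEvenZero A j).indicator (fun _ => (1 : ℝ)) y) atTop (𝓝 a) ∧
      ((∀ k, y ∈ agreeUpTo A k) →
        a = (⋃ j, evenZeroFrom j).indicator (fun _ => (1 : ℝ)) (toCantor (y 0))) := by
    intro y
    by_cases hy : ∀ k, y ∈ agreeUpTo A k
    · have hmem : ∀ j, y ∈ agreeEvenZero A j ↔ toCantor (y 0) ∈ evenZeroFrom j := fun j =>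
        ⟨fun h b hb he => h.2 (b + 1) (hy _) b (by omega) hb he,
          fun h => ⟨hy j, fun k _ b _ hb he => h b hb he⟩⟩
      refine ⟨_, ?_, fun _ => rfl⟩
      by_cases hx : toCantor (y 0) ∈ ⋃ j, evenZeroFrom j
      · rw [indicator_of_mem hx]
        obtain ⟨M, hM⟩ := mem_iUnion.1 hx
        refine tendsto_const_nhds.congr' (eventually_atTop.2 ⟨M, fun j hj => ?_⟩)
        exact (indicator_of_mem (s := agreeEvenZero A j)
          ((hmem j).2 (monotone_evenZeroFrom hj hM)) fun _ => (1 : ℝ)).symm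
      · rw [indicator_of_notMem hx]
        refine tendsto_const_nhds.congr fun j => ?_
        exact (indicator_of_notMem (s := agreeEvenZero A j)
          (fun h => hx (mem_iUnion.2 ⟨j, (hmem j).1 h⟩)) fun _ => (1 : ℝ)).symm
    · refine ⟨0, ?_, fun h => absurd h hy⟩
      push Not at hy
      obtain ⟨k, hk⟩ := hy
      refine tendsto_const_nhds.congr' (eventually_atTop.2 ⟨k, fun j hj => ?_⟩)
      exact (indicator_of_notMem (s := agreeEvenZero A j)
        (fun h => hk (antitone_agreeUpTo hj h.1)) fun _ => (1 : ℝ)).symm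
  choose f hf hfd using hlim
  refine ⟨f, ⟨fun j => (agreeEvenZero A j).indicator fun _ => (1 : ℝ), fun j => ?_, hf⟩,
    fun x => hfd _ (hdiag x)⟩
  have h : IsClopen (agreeEvenZero A j) := ⟨isClosed_agreeEvenZero j, isOpen_agreeEvenZero hA j⟩
  exact continuous_const.indicator fun x hx => by simp [h.frontier_eq] at hx

end CantorIsolating

open CantorIsolating CantorSet

theorem mainTheorem4 :
    ∃ A : ℕ → Set CantorSet,
      -- the sets `A n` partition the Cantor set
      Pairwise (Function.onFun Disjoint A) ∧ (⋃ n, A n) = Set.univ ∧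
      -- every factor is Lindelöf; the factors and the full product are completely regular (and T1)
      (∀ n, LindelofSpace (CantorIsolating (A n))) ∧
      (∀ n, T35Space (CantorIsolating (A n))) ∧
      T35Space (∀ n, CantorIsolating (A n)) ∧
      -- all finite initial products are Lindelöf
      (∀ n : ℕ, LindelofSpace (∀ k : Fin n, CantorIsolating (A k))) ∧
      -- a Baire-one function that is not a pointwise limit of a sequence from `CF`
      ∃ f : (∀ n, CantorIsolating (A n)) → ℝ,
        IsBaireOne f ∧
        ¬ ∃ g : ℕ → (∀ n, CantorIsolating (A n)) → ℝ,
          (∀ m, g m ∈ CF (fun n => CantorIsolating (A n)) ℝ) ∧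
          ∀ x, Tendsto (fun m => g m x) atTop (𝓝 (f x)) := by
  obtain ⟨c, hc⟩ := exists_bernstein_colouring
  have hA : IsPowerBernstein fun n => c ⁻¹' {n} := hc
  have hU : (⋃ n, c ⁻¹' {n}) = univ := eq_univ_of_forall fun x => mem_iUnion.2 ⟨c x, rfl⟩
  refine ⟨fun n => c ⁻¹' {n}, pairwise_disjoint_fiber c, hU, hA.lindelofSpace,
    fun n => inferInstance, inferInstance, fun n => hA.lindelofSpace_pi_fin n Fin.val, ?_⟩
  obtain ⟨f, hf, hfd⟩ := exists_isBaireOne_diag hU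
  refine ⟨f, hf, ?_⟩
  rintro ⟨g, hg, hgf⟩
  refine not_tendsto_of_countable_not_continuousAt
    (h := fun m x => g m fun n => ofCantor (c ⁻¹' {n}) x)
    (fun m => hA.countable_not_continuousAt_diag (hg m)) (fun x hx => ?_) fun x hx => ?_
  · have h := hgf fun n => ofCantor (c ⁻¹' {n}) x
    rwa [hfd, indicator_of_mem hx] at h
  · have h := hgf fun n => ofCantor (c ⁻¹' {n}) x
    rwa [hfd, indicator_of_notMem hx] at h
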